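/- Let $N,n\in\mathbb{N}$, let $\mathbf{a}=(a_1,\dots,a_N)$ be a vector of positive integers and let $p\in(1,\infty)$. For a multi-index $\alpha\in\mathbb{Z}_{\ge 0}^N$ put $\langle\alpha,\mathbf{a}^{-1}\rangle=\sum_{j=1}^N\alpha_j/a_j$, let $m$ be the number of $\alpha$ with $\langle\alpha,\mathbf{a}^{-1}\rangle=1$, and for $u\colon\Omega\subset\mathbb{R}^N\to\mathbb{R}^n$ let $\nabla_{\mathbf{a}}u=(\partial^\alpha u)_{\langle\alpha,\mathbf{a}^{-1}\rangle=1}$, with values in $\mathbb{R}^{n\times m}$, which carries the Euclidean norm $|\cdot|$. Let $W^{\mathbf{a},p}(\Omega;\mathbb{R}^n)$ be the space of $u\in L^p(\Omega;\mathbb{R}^n)$ whose distributional derivatives $\partial^\alpha u$ with $\langle\alpha,\mathbf{a}^{-1}\rangle\le 1$ lie in $L^p$, normed by $\sum_{\langle\alpha,\mathbf{a}^{-1}\rangle\le 1}\|\partial^\alpha u\|_{L^p}$; let $W^{\mathbf{a},p}_0(\Omega;\mathbb{R}^n)$ be the closure of $C_c^\infty(\Omega;\mathbb{R}^n)$ in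 it, and for $g\in W^{\mathbf{a},p}(\mathbb{R}^N;\mathbb{R}^n)$ let $W^{\mathbf{a},p}_g(\Omega)=\{g+\phi:\phi\in W^{\mathbf{a},p}_0(\Omega;\mathbb{R}^n)\}$. Let $F\colon\mathbb{R}^{n\times m}\to[0,\infty)$ be a continuous function such that: (i) $F$ is $L^p$ coercive: there are a non-empty bounded open set $\Omega\subset\mathbb{R}^N$ and $g\in W^{\mathbf{a},p}(\mathbb{R}^N;\mathbb{R}^n)$ such that $\int_\Omega F(\nabla_{\mathbf{a}}u_j)\,dx\to\infty$ for every sequence $u_j\in W^{\mathbf{a},p}_g(\Omega)$ with $\|\nabla_{\mathbf{a}}u_j\|_{L^p(\Omega)}\to\infty$ (in particular, it suffices that this holds for all bounded open Lipschitz sets $\Omega$ and all $g$); (ii) there is $C\in\mathbb{R}$ with $F(X)\le C(|X|^p+1)$ for all $X\in\mathbb{R}^{n\times m}$; (iii) there is $D\in\mathbb{R}$ with $|F(X)-F(W)|\le D\,(1+|X|^{p-1}+|W|^{p-1})\,|X-W|$ for all $X,W\in\mathbb{R}^{n\times m}$. Then the $\mathbf{a}$-quasiconvex envelope $$\mathcal{Q}F(V)=\inf\left\{\frac{1}{|Q|}\int_Q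 F(V+\nabla_{\mathbf{a}}\phi(x))\,dx:\ \phi\in C_c^\infty(Q;\mathbb{R}^n)\right\},\qquad Q=(-1,1)^N,$$ is real-valued and continuous on $\mathbb{R}^{n\times m}$. -/

import Mathlib

open MeasureTheory Filter Topology
open scoped ContDiff ENNReal

noncomputable section

namespace MixedSmoothness

variable {N : ℕ}

/-- The pairing `⟨α, a⁻¹⟩ = ∑ j, α_j / a_j` of a multi-index with the vector of reciprocals of `a`. -/
def weight (a : Fin N → ℕ+) (α : Fin N → ℕ) : ℝ :=
  ∑ j, (α j : ℝ) / (a j : ℕ)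

/-- The multi-indices `α` with `⟨α, a⁻¹⟩ = 1`; their number is `m`. -/
abbrev TopIndex (a : Fin N → ℕ+) : Type :=
  {α : Fin N → ℕ // weight a α = 1}

theorem TopIndex.le {a : Fin N → ℕ+} (α : TopIndex a) (j : Fin N) : α.1 j ≤ (a j : ℕ) := by
  have hpos : (0 : ℝ) < ((a j : ℕ) : ℝ) := by exact_mod_cast (a j).pos
  have h1 : (α.1 j : ℝ) / (a j : ℕ) ≤ weight a α.1 :=
    Finset.single_le_sum (f := fun j => (α.1 j : ℝ) / (a j : ℕ))
      (fun i _ => by positivity) (Finset.mem_univ j)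
  rw [α.2, div_le_one hpos] at h1
  exact_mod_cast h1

instance TopIndex.finite (a : Fin N → ℕ+) : Finite (TopIndex a) :=
  Finite.of_injective
    (fun (α : TopIndex a) (j : Fin N) => (⟨α.1 j, Nat.lt_succ_of_le (α.le j)⟩ : Fin ((a j : ℕ) + 1)))
    (fun _ _ h => Subtype.ext (funext fun j => congrArg Fin.val (congrFun h j)))

instance TopIndex.fintype (a : Fin N → ℕ+) : Fintype (TopIndex a) :=
  Fintype.ofFinite _

/-- The space `ℝ^{n × m}` with its Euclidean norm. -/
abbrev GradSpace (n : ℕ) (a : Fin N → ℕ+) : Type :=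
  EuclideanSpace ℝ (Fin n × TopIndex a)

/-- The first order partial derivative `∂_i f`. -/
def partialD {G : Type*} [NormedAddCommGroup G] [NormedSpace ℝ G] (i : Fin N)
    (f : EuclideanSpace ℝ (Fin N) → G) : EuclideanSpace ℝ (Fin N) → G :=
  fun x => fderiv ℝ f x (EuclideanSpace.single i 1)

/-- The partial derivative `∂^α f = ∂_1^{α_1} ⋯ ∂_N^{α_N} f`. -/
def multiD {G : Type*} [NormedAddCommGroup G] [NormedSpace ℝ G] (α : Fin N → ℕ)
    (f : EuclideanSpace ℝ (Fin N) → G) : EuclideanSpace ℝ (Fin N) → G :=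
  (List.finRange N).foldr (fun i g => (partialD i)^[α i] g) f

/-- `φ ∈ C_c^∞(Ω; G)`. -/
def IsTest {G : Type*} [NormedAddCommGroup G] [NormedSpace ℝ G]
    (Ω : Set (EuclideanSpace ℝ (Fin N))) (φ : EuclideanSpace ℝ (Fin N) → G) : Prop :=
  ContDiff ℝ ∞ φ ∧ HasCompactSupport φ ∧ tsupport φ ⊆ Ω

/-- The (classical) `a`-gradient `∇_a φ = (∂^α φ)_{⟨α, a⁻¹⟩ = 1}` of a smooth map; its `i`-th row
consists of the derivatives of the `i`-th component. -/
def aGrad {n : ℕ} (a : Fin N → ℕ+)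
    (φ : EuclideanSpace ℝ (Fin N) → EuclideanSpace ℝ (Fin n)) :
    EuclideanSpace ℝ (Fin N) → GradSpace n a :=
  fun x => WithLp.toLp 2 fun k => multiD k.2.1 φ x k.1

/-- The (interior of the) cube `[-1, 1]^N`. -/
def cube (N : ℕ) : Set (EuclideanSpace ℝ (Fin N)) :=
  {x | ∀ i, x i ∈ Set.Ioo (-1 : ℝ) 1}

/-- The `a`-quasiconvex envelope
`𝒬F(V) = inf {⨍_Q F(V + ∇_a φ) dx : φ ∈ C_c^∞(Q; ℝⁿ)}`, with values in the extended reals. -/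
def qcEnvelope {n : ℕ} (a : Fin N → ℕ+) (F : GradSpace n a → ℝ) (V : GradSpace n a) : EReal :=
  ⨅ φ : {φ : EuclideanSpace ℝ (Fin N) → EuclideanSpace ℝ (Fin n) // IsTest (cube N) φ},
    ((⨍ x in cube N, F (V + aGrad a φ.1 x) : ℝ) : EReal)

/-- `v` is the distributional derivative `∂^α u` on the open set `Ω`. -/
def HasWeakDeriv {n : ℕ} (α : Fin N → ℕ) (Ω : Set (EuclideanSpace ℝ (Fin N)))
    (u v : EuclideanSpace ℝ (Fin N) → EuclideanSpace ℝ (Fin n)) : Prop :=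
  LocallyIntegrableOn u Ω ∧ LocallyIntegrableOn v Ω ∧
    ∀ ψ : EuclideanSpace ℝ (Fin N) → ℝ, IsTest Ω ψ →
      ∫ x in Ω, multiD α ψ x • u x = (-1 : ℝ) ^ (∑ j, α j) • ∫ x in Ω, ψ x • v x

/-- `U` is (a representative of) the weak `a`-gradient `∇_a u` on `Ω`. -/
def HasWeakGrad {n : ℕ} (a : Fin N → ℕ+) (Ω : Set (EuclideanSpace ℝ (Fin N)))
    (u : EuclideanSpace ℝ (Fin N) → EuclideanSpace ℝ (Fin n))
    (U : EuclideanSpace ℝ (Fin N) → GradSpace n a) : Prop :=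
  ∀ α : TopIndex a, HasWeakDeriv α.1 Ω u fun x => WithLp.toLp 2 fun i => U x (i, α)

/-- `u ∈ W^{a,p}(Ω; ℝⁿ)`: `u ∈ L^p(Ω)` and all distributional derivatives `∂^α u` with
`⟨α, a⁻¹⟩ ≤ 1` lie in `L^p(Ω)`. -/
def MemW {n : ℕ} (a : Fin N → ℕ+) (p : ℝ) (Ω : Set (EuclideanSpace ℝ (Fin N)))
    (u : EuclideanSpace ℝ (Fin N) → EuclideanSpace ℝ (Fin n)) : Prop :=
  MemLp u (ENNReal.ofReal p) (volume.restrict Ω) ∧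
    ∀ α : Fin N → ℕ, weight a α ≤ 1 →
      ∃ v, MemLp v (ENNReal.ofReal p) (volume.restrict Ω) ∧ HasWeakDeriv α Ω u v

/-- `u ∈ W^{a,p}_0(Ω; ℝⁿ)`, the completion of `C_c^∞(Ω; ℝⁿ)` in the norm
`∑_{⟨α, a⁻¹⟩ ≤ 1} ‖∂^α u‖_{L^p(Ω)}`, realised as a space of functions on `Ω`: the function `u` lies
in `W^{a,p}(Ω; ℝⁿ)` and is the limit in this norm of a sequence of test functions. -/
def MemW0 {n : ℕ} (a : Fin N → ℕ+) (p : ℝ) (Ω : Set (EuclideanSpace ℝ (Fin N)))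
    (u : EuclideanSpace ℝ (Fin N) → EuclideanSpace ℝ (Fin n)) : Prop :=
  MemW a p Ω u ∧
    ∃ φ : ℕ → EuclideanSpace ℝ (Fin N) → EuclideanSpace ℝ (Fin n),
      (∀ k, IsTest Ω (φ k)) ∧
      ∀ α : Fin N → ℕ, weight a α ≤ 1 → ∃ v, HasWeakDeriv α Ω u v ∧
        Tendsto (fun k => eLpNorm (multiD α (φ k) - v) (ENNReal.ofReal p) (volume.restrict Ω))
          atTop (𝓝 0)

/-- The Dirichlet class `W^{a,p}_g(Ω) = {g + φ : φ ∈ W^{a,p}_0(Ω)}`. -/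
def dirichletClass {n : ℕ} (a : Fin N → ℕ+) (p : ℝ) (Ω : Set (EuclideanSpace ℝ (Fin N)))
    (g : EuclideanSpace ℝ (Fin N) → EuclideanSpace ℝ (Fin n)) :
    Set (EuclideanSpace ℝ (Fin N) → EuclideanSpace ℝ (Fin n)) :=
  {u | ∃ φ, MemW0 a p Ω φ ∧ u = g + φ}

/-- The functional `I(u, Ω) = ∫_Ω F(∇_a u) dx` is `L^q` coercive on `W^{a,p}_g(Ω)`: for every
sequence `u_j` in the Dirichlet class with `‖∇_a u_j‖_{L^q(Ω)} → ∞` one has `I(u_j, Ω) → ∞`.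
Here `U j` is a representative of the weak `a`-gradient of `u j`. -/
def CoerciveOn {n : ℕ} (a : Fin N → ℕ+) (p q : ℝ) (F : GradSpace n a → ℝ)
    (Ω : Set (EuclideanSpace ℝ (Fin N)))
    (g : EuclideanSpace ℝ (Fin N) → EuclideanSpace ℝ (Fin n)) : Prop :=
  ∀ (u : ℕ → EuclideanSpace ℝ (Fin N) → EuclideanSpace ℝ (Fin n))
    (U : ℕ → EuclideanSpace ℝ (Fin N) → GradSpace n a),
    (∀ j, u j ∈ dirichletClass a p Ω g) → (∀ j, HasWeakGrad a Ω (u j) (U j)) →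
    Tendsto (fun j => eLpNorm (U j) (ENNReal.ofReal q) (volume.restrict Ω)) atTop (𝓝 (⊤ : ℝ≥0∞)) →
    Tendsto (fun j => ∫ x in Ω, F (U j x)) atTop atTop

/-- The integrand `F` is `L^p` coercive: its functional is `L^p` coercive on the Dirichlet class of
some datum `g ∈ W^{a,p}(ℝ^N; ℝⁿ)` on some non-empty bounded open set. Requiring this for one
pair `(Ω, g)` only makes it the weakest of the usual forms of the condition. -/
def LpCoercive {n : ℕ} (a : Fin N → ℕ+) (p : ℝ) (F : GradSpace n a → ℝ) : Prop :=
  ∃ (Ω : Set (EuclideanSpace ℝ (Fin N)))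
    (g : EuclideanSpace ℝ (Fin N) → EuclideanSpace ℝ (Fin n)),
    IsOpen Ω ∧ Bornology.IsBounded Ω ∧ Ω.Nonempty ∧ MemW a p Set.univ g ∧ CoerciveOn a p p F Ω g

end MixedSmoothness

end

open MixedSmoothness

/-! Let `φ` be a test map on the cube whose energy `T = ⨍ ‖∇_a φ‖ ^ p` is huge, while
`⨍ F(V + ∇_a φ)` is bounded. The anisotropic rescaling `r φ(δ_{1/r}(x - x₀))` preserves the values
of `∇_a φ`, so it moves `φ` to a box in the coercivity domain `Ω`, and a box of volume `k / T` gives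
the rescaled map `ψ` the energy `∫ ‖∇_a ψ‖ ^ p = k`. On the box, the `p`-Lipschitz condition and
Young's inequality allow one to replace the affine part `V` by the weak gradient of the boundary
datum `g`, at a cost of a constant multiple of `∫ ‖∇_a ψ‖ ^ p / k` plus a term which is small
because the box is. Hence `∫ F(∇_a (g + ψ))` is bounded independently of `k`, which contradicts
coercivity once `k` is large. So a bound on `⨍ F(V + ∇_a φ)` bounds the energy of `φ`, locally
uniformly in `V`. On test maps of bounded energy the functions `V ↦ ⨍ F(V + ∇_a φ)` are uniformly
Lipschitz on balls, and only these test maps matter for the infimum. -/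

namespace MixedSmoothness

open scoped NNReal

variable {N n : ℕ} {G : Type*} [NormedAddCommGroup G] [NormedSpace ℝ G]

/-! ### Iterated partial derivatives -/

section Derivatives

variable {Ω Ω' : Set (EuclideanSpace ℝ (Fin N))} {f : EuclideanSpace ℝ (Fin N) → G}

/-- The multi-index `α` as the list in which each `i` occurs `α i` times, in increasing order. It
turns `∂^α` into a single fold, so that statements about `∂^α` become inductions on a list. -/
def multiIndexList (α : Fin N → ℕ) : List (Fin N) :=
  (List.finRange N).flatMap fun i => List.replicate (α i) i

theorem multiD_eq_foldr (α : Fin N → ℕ) (f : EuclideanSpace ℝ (Fin N) → G) :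
    multiD α f = (multiIndexList α).foldr partialD f := by
  have iterate_eq (i : Fin N) (k : ℕ) (g : EuclideanSpace ℝ (Fin N) → G) :
      (List.replicate k i).foldr partialD g = (partialD i)^[k] g := by
    induction k with
    | zero => rfl
    | succ k ih => rw [List.replicate_succ, List.foldr_cons, ih, Function.iterate_succ_apply']
  simp only [multiD, multiIndexList, List.foldr_flatMap, iterate_eq]

theorem prod_map_multiIndexList {M : Type*} [CommMonoid M] (α : Fin N → ℕ) (c : Fin N → M) :
    ((multiIndexList α).map c).prod = ∏ i, c i ^ α i := by
  simp only [multiIndexList, List.map_flatMap, List.map_replicate, Fin.prod_univ_def]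
  induction List.finRange N with
  | nil => rfl
  | cons i l ih => simp only [List.flatMap_cons, List.prod_append, List.prod_replicate, ih,
      List.map_cons, List.prod_cons]

theorem length_multiIndexList (α : Fin N → ℕ) : (multiIndexList α).length = ∑ i, α i := by
  simp only [multiIndexList, List.length_flatMap, List.length_replicate, Fin.sum_univ_def]

theorem contDiff_partialD (i : Fin N) (hf : ContDiff ℝ ∞ f) : ContDiff ℝ ∞ (partialD i f) :=
  (hf.fderiv_right (m := ∞) (by simp)).clm_apply contDiff_const

theorem contDiff_foldr_partialD (l : List (Fin N)) (hf : ContDiff ℝ ∞ f) :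
    ContDiff ℝ ∞ (l.foldr partialD f) := by
  induction l with
  | nil => exact hf
  | cons i l ih => exact contDiff_partialD i ih

theorem contDiff_multiD (α : Fin N → ℕ) (hf : ContDiff ℝ ∞ f) : ContDiff ℝ ∞ (multiD α f) :=
  multiD_eq_foldr α f ▸ contDiff_foldr_partialD _ hf

theorem partialD_comm (i j : Fin N) (hf : ContDiff ℝ ∞ f) :
    partialD i (partialD j f) = partialD j (partialD i f) := by
  have hd : Differentiable ℝ (fderiv ℝ f) :=
    (hf.fderiv_right (m := ∞) (by simp)).differentiable (by simp)
  have second_derivative (k : Fin N) (x v : EuclideanSpace ℝ (Fin N)) :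
      fderiv ℝ (partialD k f) x v = fderiv ℝ (fderiv ℝ f) x v (EuclideanSpace.single k 1) := by
    unfold partialD
    rw [fderiv_clm_apply (hd x) (differentiableAt_const _)]
    simp
  funext x
  have symm : IsSymmSndFDerivAt ℝ f x :=
    hf.contDiffAt.isSymmSndFDerivAt (by simpa using ENat.LEInfty.out)
  exact (second_derivative j x _).trans ((symm _ _).trans (second_derivative i x _).symm)

theorem partialD_foldr_comm (i : Fin N) (l : List (Fin N)) (hf : ContDiff ℝ ∞ f) :
    partialD i (l.foldr partialD f) = l.foldr partialD (partialD i f) := by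
  induction l with
  | nil => rfl
  | cons j l ih =>
    rw [List.foldr_cons, List.foldr_cons, ← ih, partialD_comm i j (contDiff_foldr_partialD l hf)]

theorem IsTest.continuous (hf : IsTest Ω f) : Continuous f := hf.1.continuous

theorem IsTest.mono (h : Ω ⊆ Ω') (hf : IsTest Ω f) : IsTest Ω' f :=
  ⟨hf.1, hf.2.1, hf.2.2.trans h⟩

theorem IsTest.eq_zero (hf : IsTest Ω f) {x : EuclideanSpace ℝ (Fin N)} (hx : x ∉ Ω) : f x = 0 :=
  image_eq_zero_of_notMem_tsupport fun h => hx (hf.2.2 h)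

theorem isTest_zero (Ω : Set (EuclideanSpace ℝ (Fin N))) :
    IsTest Ω (0 : EuclideanSpace ℝ (Fin N) → G) :=
  ⟨contDiff_const, HasCompactSupport.zero, by simp⟩

theorem IsTest.partialD (i : Fin N) (hf : IsTest Ω f) : IsTest Ω (partialD i f) :=
  ⟨contDiff_partialD i hf.1, hf.2.1.fderiv_apply ℝ _,
    (tsupport_fderiv_apply_subset ℝ _).trans hf.2.2⟩

theorem IsTest.multiD (α : Fin N → ℕ) (hf : IsTest Ω f) : IsTest Ω (multiD α f) := by
  rw [multiD_eq_foldr]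
  induction multiIndexList α with
  | nil => exact hf
  | cons i l ih => exact ih.partialD i

theorem IsTest.memLp {p : ℝ≥0∞} {μ : Measure (EuclideanSpace ℝ (Fin N))}
    [IsFiniteMeasureOnCompacts μ] (hf : IsTest Ω f) : MemLp f p μ :=
  hf.continuous.memLp_of_hasCompactSupport hf.2.1

end Derivatives

/-! ### Integration by parts and weak derivatives -/

section WeakDerivatives

variable {Ω Ω' : Set (EuclideanSpace ℝ (Fin N))} {ψ : EuclideanSpace ℝ (Fin N) → ℝ}

theorem IsTest.setIntegral_smul (u : EuclideanSpace ℝ (Fin N) → G) (hψ : IsTest Ω ψ) :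
    ∫ x in Ω, ψ x • u x = ∫ x, ψ x • u x :=
  setIntegral_eq_integral_of_forall_compl_eq_zero fun x hx => by rw [hψ.eq_zero hx, zero_smul]

theorem IsTest.integrable_smul {u : EuclideanSpace ℝ (Fin N) → G} (hψ : IsTest Ω ψ)
    (hu : LocallyIntegrableOn u Ω) : Integrable fun x => ψ x • u x := by
  have hK : IsCompact (tsupport ψ) := hψ.2.1
  refine (integrableOn_iff_integrable_of_support_subset (s := tsupport ψ) ?_).1
    ((hu.integrableOn_compact_subset hψ.2.2 hK).continuousOn_smul hψ.continuous.continuousOn hK)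
  exact (Function.support_smul_subset_left ψ u).trans (subset_tsupport ψ)

theorem integral_partialD_smul (i : Fin N) {u : EuclideanSpace ℝ (Fin N) → G} (hψ : IsTest Ω ψ)
    (hu : ContDiff ℝ ∞ u) : ∫ x, partialD i ψ x • u x = -∫ x, ψ x • partialD i u x := by
  have locallyIntegrable {v : EuclideanSpace ℝ (Fin N) → G} (hv : ContDiff ℝ ∞ v) :
      LocallyIntegrableOn v Ω := hv.continuous.locallyIntegrable.locallyIntegrableOn Ω
  have parts := integral_smul_fderiv_eq_neg_fderiv_smul_of_integrable (μ := volume)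
    (v := EuclideanSpace.single i 1)
    ((hψ.partialD i).integrable_smul (locallyIntegrable hu))
    (hψ.integrable_smul (locallyIntegrable (contDiff_partialD i hu)))
    (hψ.integrable_smul (locallyIntegrable hu))
    (fun x _ => hψ.1.differentiable (by simp) x) (fun x _ => hu.differentiable (by simp) x)
  exact (neg_eq_iff_eq_neg.2 parts).symm

theorem integral_foldr_partialD_smul (l : List (Fin N)) {u : EuclideanSpace ℝ (Fin N) → G}
    (hψ : IsTest Ω ψ) (hu : ContDiff ℝ ∞ u) :
    ∫ x, l.foldr partialD ψ x • u x =
      (-1 : ℝ) ^ l.length • ∫ x, ψ x • l.foldr partialD u x := by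
  induction l generalizing ψ with
  | nil => simp
  | cons i l ih =>
    rw [List.foldr_cons, partialD_foldr_comm i l hψ.1, ih (hψ.partialD i),
      integral_partialD_smul i hψ (contDiff_foldr_partialD l hu), List.foldr_cons,
      List.length_cons, pow_succ, mul_smul, neg_one_smul]

theorem hasWeakDeriv_multiD (Ω : Set (EuclideanSpace ℝ (Fin N))) (α : Fin N → ℕ)
    {φ : EuclideanSpace ℝ (Fin N) → EuclideanSpace ℝ (Fin n)} (hφ : ContDiff ℝ ∞ φ) :
    HasWeakDeriv α Ω φ (multiD α φ) := by
  refine ⟨hφ.continuous.locallyIntegrable.locallyIntegrableOn _,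
    (contDiff_multiD α hφ).continuous.locallyIntegrable.locallyIntegrableOn _, fun ψ hψ => ?_⟩
  rw [(hψ.multiD α).setIntegral_smul, hψ.setIntegral_smul, multiD_eq_foldr, multiD_eq_foldr,
    integral_foldr_partialD_smul _ hψ hφ, length_multiIndexList]

variable {α : Fin N → ℕ} {u v u' v' : EuclideanSpace ℝ (Fin N) → EuclideanSpace ℝ (Fin n)}

theorem HasWeakDeriv.mono (h : HasWeakDeriv α Ω' u v) (hΩ : Ω ⊆ Ω') : HasWeakDeriv α Ω u v := by
  refine ⟨h.1.mono_set hΩ, h.2.1.mono_set hΩ, fun ψ hψ => ?_⟩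
  have parts := h.2.2 ψ (hψ.mono hΩ)
  rw [((hψ.mono hΩ).multiD α).setIntegral_smul, (hψ.mono hΩ).setIntegral_smul] at parts
  rw [(hψ.multiD α).setIntegral_smul, hψ.setIntegral_smul, parts]

theorem HasWeakDeriv.add (h : HasWeakDeriv α Ω u v) (h' : HasWeakDeriv α Ω u' v') :
    HasWeakDeriv α Ω (u + u') (v + v') := by
  refine ⟨h.1.add h'.1, h.2.1.add h'.2.1, fun ψ hψ => ?_⟩
  simp only [Pi.add_apply, smul_add]
  rw [integral_add ((hψ.multiD α).integrable_smul h.1).integrableOn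
      ((hψ.multiD α).integrable_smul h'.1).integrableOn,
    integral_add (hψ.integrable_smul h.2.1).integrableOn
      (hψ.integrable_smul h'.2.1).integrableOn, h.2.2 ψ hψ, h'.2.2 ψ hψ, smul_add]

theorem IsTest.memW0 (a : Fin N → ℕ+) (p : ℝ) (hu : IsTest Ω u) : MemW0 a p Ω u := by
  refine ⟨⟨hu.memLp, fun α _ => ⟨_, (hu.multiD α).memLp, hasWeakDeriv_multiD Ω α hu.1⟩⟩,
    fun _ => u, fun _ => hu, fun α _ => ⟨_, hasWeakDeriv_multiD Ω α hu.1, ?_⟩⟩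
  simp

theorem HasWeakGrad.mono {a : Fin N → ℕ+} {U : EuclideanSpace ℝ (Fin N) → GradSpace n a}
    (h : HasWeakGrad a Ω' u U) (hΩ : Ω ⊆ Ω') : HasWeakGrad a Ω u U :=
  fun α => (h α).mono hΩ

theorem HasWeakGrad.add_aGrad {a : Fin N → ℕ+} {U : EuclideanSpace ℝ (Fin N) → GradSpace n a}
    (h : HasWeakGrad a Ω u U) (hv : ContDiff ℝ ∞ v) : HasWeakGrad a Ω (u + v) (U + aGrad a v) :=
  fun α => (h α).add (hasWeakDeriv_multiD Ω α.1 hv)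

theorem MemW.exists_hasWeakGrad {a : Fin N → ℕ+} {p : ℝ} (hu : MemW a p Ω u) :
    ∃ U : EuclideanSpace ℝ (Fin N) → GradSpace n a,
      MemLp U (ENNReal.ofReal p) (volume.restrict Ω) ∧ HasWeakGrad a Ω u U := by
  choose w hw huw using fun α : TopIndex a => hu.2 α.1 α.2.le
  exact ⟨fun x => WithLp.toLp 2 fun k => w k.2 x k.1,
    MemLp.of_eval_piLp fun k => (hw k.2).eval_piLp k.1, huw⟩

end WeakDerivatives

section TestGradients

variable {Ω : Set (EuclideanSpace ℝ (Fin N))} (a : Fin N → ℕ+)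
  {φ : EuclideanSpace ℝ (Fin N) → EuclideanSpace ℝ (Fin n)}

theorem IsTest.continuous_aGrad (hφ : IsTest Ω φ) : Continuous (aGrad a φ) :=
  (PiLp.continuous_toLp 2 _).comp <| continuous_pi fun k =>
    (EuclideanSpace.proj (𝕜 := ℝ) k.1).continuous.comp (hφ.multiD k.2.1).continuous

theorem IsTest.aGrad_eq_zero (hφ : IsTest Ω φ) {x : EuclideanSpace ℝ (Fin N)} (hx : x ∉ Ω) :
    aGrad a φ x = 0 := by
  ext k
  simp [aGrad, (hφ.multiD k.2.1).eq_zero hx]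

theorem IsTest.hasCompactSupport_aGrad (hφ : IsTest Ω φ) : HasCompactSupport (aGrad a φ) :=
  have hφ' : IsTest (tsupport φ) φ := ⟨hφ.1, hφ.2.1, subset_rfl⟩
  HasCompactSupport.intro hφ.2.1 fun _ hx => hφ'.aGrad_eq_zero a hx

theorem IsTest.memLp_aGrad {p : ℝ≥0∞} {μ : Measure (EuclideanSpace ℝ (Fin N))}
    [IsFiniteMeasureOnCompacts μ] (hφ : IsTest Ω φ) : MemLp (aGrad a φ) p μ :=
  (hφ.continuous_aGrad a).memLp_of_hasCompactSupport (hφ.hasCompactSupport_aGrad a)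

end TestGradients

/-! ### Anisotropic rescaling -/

section Cube

theorem isOpen_cube (N : ℕ) : IsOpen (cube N) := by
  simp only [cube, Set.ofPred_forall]
  exact isOpen_iInter_of_finite fun i => isOpen_Ioo.preimage (by fun_prop)

theorem isBounded_cube (N : ℕ) : Bornology.IsBounded (cube N) := by
  have pi_bounded : Bornology.IsBounded (Set.univ.pi fun _ : Fin N => Set.Ioo (-1 : ℝ) 1) :=
    Bornology.IsBounded.pi fun _ => Metric.isBounded_Ioo _ _
  refine ((PiLp.antilipschitzWith_ofLp 2 _).isBounded_preimage pi_bounded).subset fun x hx => ?_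
  simpa [cube] using hx

theorem volume_cube_pos (N : ℕ) : 0 < volume (cube N) :=
  (isOpen_cube N).measure_pos volume ⟨0, fun _ => by simp⟩

theorem volume_real_cube_pos (N : ℕ) : 0 < volume.real (cube N) :=
  ENNReal.toReal_pos (volume_cube_pos N).ne' (isBounded_cube N).measure_lt_top.ne

end Cube

section Rescaling

variable (a : Fin N → ℕ+) (x₀ : EuclideanSpace ℝ (Fin N)) {r : ℝ}

/-- The anisotropic dilation `x ↦ (r^{1/a_i} x_i)_i`, with respect to which the derivatives
`∂^α` with `⟨α, a⁻¹⟩ = 1` are homogeneous of degree one. -/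
noncomputable def dilation (r : ℝ) : EuclideanSpace ℝ (Fin N) →L[ℝ] EuclideanSpace ℝ (Fin N) :=
  (Matrix.toLpLin 2 2
    (Matrix.diagonal fun i => r ^ (1 / ((a i : ℕ) : ℝ)))).toContinuousLinearMap

/-- The affine map `x ↦ δ_{1/r} (x - x₀)`, where `δ` is the anisotropic dilation. It blows the box
of size `r` around `x₀` up to the unit cube. -/
noncomputable def rescale (r : ℝ) (x : EuclideanSpace ℝ (Fin N)) : EuclideanSpace ℝ (Fin N) :=
  dilation a r⁻¹ (x - x₀)

/-- The open box with centre `x₀` and half side lengths `r^{1/a_i}`, as the preimage of the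
cube. -/
noncomputable def box (r : ℝ) : Set (EuclideanSpace ℝ (Fin N)) :=
  rescale a x₀ r ⁻¹' cube N

theorem dilation_apply (r : ℝ) (x : EuclideanSpace ℝ (Fin N)) (i : Fin N) :
    dilation a r x i = r ^ (1 / ((a i : ℕ) : ℝ)) * x i := by
  simp [dilation, Matrix.toLpLin_apply, Matrix.mulVec_diagonal]

theorem dilation_single (r : ℝ) (i : Fin N) :
    dilation a r (EuclideanSpace.single i 1) =
      r ^ (1 / ((a i : ℕ) : ℝ)) • EuclideanSpace.single i 1 := by
  ext j
  rw [dilation_apply]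
  by_cases h : j = i <;> simp [h]

theorem dilation_zero : dilation a 0 = 0 := by
  ext x i
  rw [dilation_apply, Real.zero_rpow (by simp)]
  simp

theorem dilation_dilation_inv (hr : 0 < r) (x : EuclideanSpace ℝ (Fin N)) :
    dilation a r (dilation a r⁻¹ x) = x := by
  ext i
  rw [dilation_apply, dilation_apply, ← mul_assoc, ← Real.mul_rpow hr.le (inv_nonneg.2 hr.le),
    mul_inv_cancel₀ hr.ne', Real.one_rpow, one_mul]

theorem continuous_dilation :
    Continuous fun q : ℝ × EuclideanSpace ℝ (Fin N) => dilation a q.1 q.2 := by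
  have coordinate (i : Fin N) :
      Continuous fun q : ℝ × EuclideanSpace ℝ (Fin N) => dilation a q.1 q.2 i := by
    simp only [dilation_apply]
    exact ((Real.continuous_rpow_const (by simp)).comp continuous_fst).mul
      ((EuclideanSpace.proj (𝕜 := ℝ) i).continuous.comp continuous_snd)
  exact (PiLp.continuous_toLp 2 _).comp (continuous_pi coordinate)

theorem prod_rpow_one_div_pow (hr : 0 < r) (α : Fin N → ℕ) :
    ∏ i, (r ^ (1 / ((a i : ℕ) : ℝ))) ^ α i = r ^ weight a α := by
  rw [weight, Real.rpow_sum_of_pos hr]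
  refine Finset.prod_congr rfl fun i _ => ?_
  rw [← Real.rpow_mul_natCast hr.le, one_div_mul_eq_div]

theorem map_dilation (hr : 0 < r) :
    Measure.map (dilation a r) volume = ENNReal.ofReal (r ^ weight a 1)⁻¹ • volume := by
  have det_eq : (dilation a r).toLinearMap.det = r ^ weight a 1 := by
    rw [← prod_rpow_one_div_pow a hr]
    simp [dilation, LinearMap.det_toLpLin, Matrix.det_diagonal]
  have pos : 0 < r ^ weight a 1 := Real.rpow_pos_of_pos hr _
  have map_eq := Measure.map_linearMap_addHaar_eq_smul_addHaar
    (volume : Measure (EuclideanSpace ℝ (Fin N))) (f := (dilation a r).toLinearMap)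
    (det_eq ▸ pos.ne')
  rwa [det_eq, abs_of_pos (inv_pos.2 pos)] at map_eq

theorem rescale_leftInverse (hr : 0 < r) :
    Function.LeftInverse (fun y => x₀ + dilation a r y) (rescale a x₀ r) := fun x => by
  simp only [rescale, dilation_dilation_inv a hr, add_sub_cancel]

theorem contDiff_rescale (r : ℝ) : ContDiff ℝ ∞ (rescale a x₀ r) :=
  (dilation a r⁻¹).contDiff.comp (contDiff_id.sub contDiff_const)

theorem hasFDerivAt_rescale (r : ℝ) (x : EuclideanSpace ℝ (Fin N)) :
    HasFDerivAt (rescale a x₀ r) (dilation a r⁻¹) x := by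
  have h := (dilation a r⁻¹).hasFDerivAt.comp x ((hasFDerivAt_id x).sub_const x₀)
  rwa [ContinuousLinearMap.comp_id] at h

theorem isClosedEmbedding_rescale (hr : 0 < r) : IsClosedEmbedding (rescale a x₀ r) :=
  (rescale_leftInverse a x₀ hr).isClosedEmbedding (by fun_prop) (contDiff_rescale a x₀ r).continuous

theorem map_rescale (hr : 0 < r) :
    Measure.map (rescale a x₀ r) volume = ENNReal.ofReal (r ^ weight a 1) • volume := by
  have comp_eq : rescale a x₀ r = dilation a r⁻¹ ∘ fun x => x - x₀ := rfl
  rw [comp_eq, ← Measure.map_map (dilation a r⁻¹).measurable (by fun_prop),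
    (measurePreserving_sub_right volume x₀).map_eq, map_dilation a (inv_pos.2 hr),
    Real.inv_rpow hr.le, inv_inv]

theorem measurableSet_box (r : ℝ) : MeasurableSet (box a x₀ r) :=
  ((isOpen_cube N).preimage (contDiff_rescale a x₀ r).continuous).measurableSet

theorem volume_box (hr : 0 < r) :
    volume (box a x₀ r) = ENNReal.ofReal (r ^ weight a 1) * volume (cube N) := by
  rw [box, ← Measure.map_apply (contDiff_rescale a x₀ r).continuous.measurable
    (isOpen_cube N).measurableSet, map_rescale a x₀ hr, Measure.smul_apply, smul_eq_mul]

theorem volume_real_box (hr : 0 < r) :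
    volume.real (box a x₀ r) = r ^ weight a 1 * volume.real (cube N) := by
  rw [measureReal_def, volume_box a x₀ hr, ENNReal.toReal_mul,
    ENNReal.toReal_ofReal (Real.rpow_nonneg hr.le _), ← measureReal_def]

theorem setIntegral_box_comp_rescale (hr : 0 < r) (f : EuclideanSpace ℝ (Fin N) → G) :
    ∫ x in box a x₀ r, f (rescale a x₀ r x) =
      volume.real (box a x₀ r) • ⨍ x in cube N, f x := by
  rw [box, ← (isClosedEmbedding_rescale a x₀ hr).measurableEmbedding.setIntegral_map,
    map_rescale a x₀ hr, Measure.restrict_smul, integral_smul_measure,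
    ENNReal.toReal_ofReal (Real.rpow_nonneg hr.le _), ← box, volume_real_box a x₀ hr, mul_smul,
    measure_smul_setAverage _ (isBounded_cube N).measure_lt_top.ne]

theorem partialD_comp_rescale (r : ℝ) (i : Fin N) {f : EuclideanSpace ℝ (Fin N) → G}
    (hf : ContDiff ℝ ∞ f) :
    partialD i (f ∘ rescale a x₀ r) =
      r⁻¹ ^ (1 / ((a i : ℕ) : ℝ)) • (partialD i f ∘ rescale a x₀ r) := by
  funext x
  have chain := (hf.differentiable (by simp) (rescale a x₀ r x)).hasFDerivAt.comp x
    (hasFDerivAt_rescale a x₀ r x)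
  simp [partialD, chain.fderiv, dilation_single]

theorem partialD_const_smul (i : Fin N) (c : ℝ) (f : EuclideanSpace ℝ (Fin N) → G) :
    partialD i (c • f) = c • partialD i f := by
  funext x
  simp [partialD, fderiv_const_smul_field]

theorem foldr_partialD_smul_comp_rescale (r c : ℝ) (l : List (Fin N))
    {f : EuclideanSpace ℝ (Fin N) → G} (hf : ContDiff ℝ ∞ f) :
    l.foldr partialD (c • (f ∘ rescale a x₀ r)) =
      (c * (l.map fun i => r⁻¹ ^ (1 / ((a i : ℕ) : ℝ))).prod) •
        (l.foldr partialD f ∘ rescale a x₀ r) := by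
  induction l with
  | nil => simp
  | cons i l ih =>
    rw [List.foldr_cons, ih, partialD_const_smul,
      partialD_comp_rescale a x₀ r i (contDiff_foldr_partialD l hf), smul_smul, List.map_cons,
      List.prod_cons, mul_assoc, mul_comm (List.prod _), List.foldr_cons]

theorem multiD_smul_comp_rescale (hr : 0 < r) (c : ℝ) (α : Fin N → ℕ)
    {f : EuclideanSpace ℝ (Fin N) → G} (hf : ContDiff ℝ ∞ f) :
    multiD α (c • (f ∘ rescale a x₀ r)) =
      (c * r⁻¹ ^ weight a α) • (multiD α f ∘ rescale a x₀ r) := by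
  rw [multiD_eq_foldr, foldr_partialD_smul_comp_rescale a x₀ r c _ hf, prod_map_multiIndexList,
    prod_rpow_one_div_pow a (inv_pos.2 hr), multiD_eq_foldr]

theorem aGrad_smul_comp_rescale (hr : 0 < r)
    {φ : EuclideanSpace ℝ (Fin N) → EuclideanSpace ℝ (Fin n)} (hφ : ContDiff ℝ ∞ φ) :
    aGrad a (r • (φ ∘ rescale a x₀ r)) = aGrad a φ ∘ rescale a x₀ r := by
  funext x
  ext k
  simp only [aGrad, Function.comp_apply]
  rw [multiD_smul_comp_rescale a x₀ hr r _ hφ, k.2.2, Real.rpow_one, mul_inv_cancel₀ hr.ne',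
    one_smul, Function.comp_apply]

theorem IsTest.smul_comp_rescale (hr : 0 < r) (c : ℝ) {f : EuclideanSpace ℝ (Fin N) → G}
    (hf : IsTest (cube N) f) : IsTest (box a x₀ r) (c • (f ∘ rescale a x₀ r)) := by
  have smooth := contDiff_rescale a x₀ r
  refine ⟨contDiff_const.smul (hf.1.comp smooth),
    (hf.2.1.comp_isClosedEmbedding (isClosedEmbedding_rescale a x₀ hr)).smul_left, ?_⟩
  exact (closure_mono (Function.support_const_smul_subset c _)).trans
    ((tsupport_comp_subset_preimage f smooth.continuous).trans (Set.preimage_mono hf.2.2))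

theorem setIntegral_box_comp_aGrad (hr : 0 < r)
    {φ : EuclideanSpace ℝ (Fin N) → EuclideanSpace ℝ (Fin n)} (hφ : ContDiff ℝ ∞ φ)
    (f : GradSpace n a → ℝ) :
    ∫ x in box a x₀ r, f (aGrad a (r • (φ ∘ rescale a x₀ r)) x) =
      volume.real (box a x₀ r) * ⨍ x in cube N, f (aGrad a φ x) := by
  rw [aGrad_smul_comp_rescale a x₀ hr hφ, ← smul_eq_mul]
  exact setIntegral_box_comp_rescale a x₀ hr fun x => f (aGrad a φ x)

variable {x₀} in
theorem eventually_box_subset {U : Set (EuclideanSpace ℝ (Fin N))} (hU : U ∈ 𝓝 x₀) :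
    ∀ᶠ r in 𝓝[>] (0 : ℝ), box a x₀ r ⊆ U := by
  have near (y : EuclideanSpace ℝ (Fin N)) :
      ∀ᶠ q in 𝓝 ((0 : ℝ), y), x₀ + dilation a q.1 q.2 ∈ U := by
    refine (continuous_const.add (continuous_dilation a)).continuousAt ?_
    simpa [dilation_zero] using hU
  have uniform := (isBounded_cube N).isCompact_closure.eventually_forall_of_forall_eventually
    (P := fun r y => x₀ + dilation a r y ∈ U) fun y _ => near y
  filter_upwards [uniform.filter_mono nhdsWithin_le_nhds, self_mem_nhdsWithin] with r hr hr0 x hx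
  rw [← rescale_leftInverse a x₀ hr0 x]
  exact hr _ (subset_closure hx)

theorem weight_one_pos [NeZero N] : 0 < weight a 1 :=
  Finset.sum_pos (fun i _ => by simp) Finset.univ_nonempty

theorem tendsto_volume_box [NeZero N] :
    Tendsto (fun r => volume (box a x₀ r)) (𝓝[>] 0) (𝓝 0) := by
  have hw := weight_one_pos a
  have tendsto_factor : Tendsto (fun r => ENNReal.ofReal (r ^ weight a 1)) (𝓝[>] 0) (𝓝 0) := by
    simpa [Real.zero_rpow hw.ne'] using ENNReal.tendsto_ofReal
      (((Real.continuous_rpow_const hw.le).tendsto 0).mono_left nhdsWithin_le_nhds)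
  have tendsto_product := ENNReal.Tendsto.mul_const tendsto_factor
    (Or.inr (isBounded_cube N).measure_lt_top.ne : _ ∨ volume (cube N) ≠ ⊤)
  rw [zero_mul] at tendsto_product
  refine tendsto_product.congr' ?_
  filter_upwards [self_mem_nhdsWithin] with r hr using (volume_box a x₀ hr).symm

theorem eventually_setIntegral_box_le [NeZero N] {μ : Measure (EuclideanSpace ℝ (Fin N))}
    (hμ : μ ≤ volume) {f : EuclideanSpace ℝ (Fin N) → ℝ} (hf : Integrable f μ) {ε : ℝ}
    (hε : 0 < ε) : ∀ᶠ r in 𝓝[>] 0, ∫ x in box a x₀ r, f x ∂μ ≤ ε := by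
  have vanish : Tendsto (fun r => μ (box a x₀ r)) (𝓝[>] 0) (𝓝 0) :=
    tendsto_of_tendsto_of_tendsto_of_le_of_le tendsto_const_nhds (tendsto_volume_box a x₀)
      (fun _ => zero_le) fun r => hμ _
  exact (hf.tendsto_setIntegral_nhds_zero vanish).eventually_le_const hε

theorem exists_volume_real_box_eq [NeZero N] {P : ℝ → Prop} (hP : ∀ᶠ r in 𝓝[>] 0, P r) :
    ∀ᶠ v in 𝓝[>] 0, ∃ r > 0, P r ∧ volume.real (box a x₀ r) = v := by
  have hQ := volume_real_cube_pos N
  have hw := weight_one_pos a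
  have tendsto_radius : Tendsto (fun v => (v / volume.real (cube N)) ^ (weight a 1)⁻¹)
      (𝓝[>] 0) (𝓝[>] 0) := by
    refine tendsto_nhdsWithin_iff.2 ⟨?_, ?_⟩
    · have cont : Continuous fun v => (v / volume.real (cube N)) ^ (weight a 1)⁻¹ :=
        (Real.continuous_rpow_const (inv_nonneg.2 hw.le)).comp (continuous_id.div_const _)
      simpa [Real.zero_rpow (inv_pos.2 hw).ne'] using
        (cont.tendsto 0).mono_left nhdsWithin_le_nhds
    · filter_upwards [self_mem_nhdsWithin] with v hv
      exact Real.rpow_pos_of_pos (div_pos hv hQ) _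
  filter_upwards [tendsto_radius.eventually hP, self_mem_nhdsWithin] with v hv hv0
  have hpos : 0 < v / volume.real (cube N) := div_pos hv0 hQ
  refine ⟨_, Real.rpow_pos_of_pos hpos _, hv, ?_⟩
  rw [volume_real_box a x₀ (Real.rpow_pos_of_pos hpos _), Real.rpow_inv_rpow hpos.le hw.ne',
    div_mul_cancel₀ _ hQ.ne']

end Rescaling

/-! ### Integrands with a `p`-Lipschitz condition -/

section PowerLipschitz

variable {E X : Type*} [NormedAddCommGroup E] {mX : MeasurableSpace X} {μ : Measure X}
  {F : E → ℝ} {D : ℝ≥0} {p K k : ℝ}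

/-- The `p`-Lipschitz condition
`|F Y - F Z| ≤ D (1 + ‖Y‖ ^ (p - 1) + ‖Z‖ ^ (p - 1)) ‖Y - Z‖`, which makes `F` locally Lipschitz
and of growth at most `p`. -/
def PowerLipschitzWith (p : ℝ) (D : ℝ≥0) (F : E → ℝ) : Prop :=
  ∀ Y Z, |F Y - F Z| ≤ D * (1 + ‖Y‖ ^ (p - 1) + ‖Z‖ ^ (p - 1)) * ‖Y - Z‖

theorem rpow_sub_one_mul_self {x : ℝ} (hp : 1 ≤ p) (hx : 0 ≤ x) : x ^ (p - 1) * x = x ^ p := by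
  rw [← Real.rpow_add_one' hx (by linarith), sub_add_cancel]

theorem add_rpow_le_mul_rpow_add_rpow (hp : 1 ≤ p) {x y : ℝ} (hx : 0 ≤ x) (hy : 0 ≤ y) :
    (x + y) ^ p ≤ 2 ^ (p - 1) * (x ^ p + y ^ p) := by
  lift x to ℝ≥0 using hx
  lift y to ℝ≥0 using hy
  exact_mod_cast NNReal.rpow_add_le_mul_rpow_add_rpow x y hp

theorem add_rpow_sub_one_mul_le (hp : 1 ≤ p) (hk : 1 ≤ k) {t h : ℝ} (ht : 0 ≤ t) (hh : 0 ≤ h) :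
    (t + h) ^ (p - 1) * h ≤ 2 ^ (p - 1) * (t ^ p / k + k ^ (p - 1) * h ^ p) := by
  have hk0 : 0 < k := by linarith
  set s := max t (k * h)
  have hs : 0 ≤ s := ht.trans (le_max_left _ _)
  have sum_le : t + h ≤ 2 * s := by
    linarith [le_max_left t (k * h), le_max_right t (k * h), le_mul_of_one_le_left hh hk]
  have le_div : h ≤ s / k := (le_div_iff₀' hk0).2 (le_max_right _ _)
  have max_rpow_le : s ^ p ≤ t ^ p + (k * h) ^ p := by
    rcases max_choice t (k * h) with hmax | hmax <;> rw [show s = _ from hmax]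
    exacts [le_add_of_nonneg_right (by positivity), le_add_of_nonneg_left (by positivity)]
  calc (t + h) ^ (p - 1) * h ≤ (2 * s) ^ (p - 1) * (s / k) := by gcongr
    _ = 2 ^ (p - 1) * (s ^ p / k) := by
      rw [Real.mul_rpow (by norm_num) hs, ← rpow_sub_one_mul_self hp hs]; ring
    _ ≤ 2 ^ (p - 1) * ((t ^ p + (k * h) ^ p) / k) := by gcongr
    _ = 2 ^ (p - 1) * (t ^ p / k + k ^ (p - 1) * h ^ p) := by
      rw [Real.mul_rpow hk0.le hh, ← rpow_sub_one_mul_self hp hk0.le]; field_simp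

namespace PowerLipschitzWith

theorem abs_sub_le (hF : PowerLipschitzWith p D F) (hp : 1 ≤ p) {Y Z : E} {R : ℝ} (hR : 1 ≤ R)
    (hY : ‖Y‖ ≤ R) (hZ : ‖Z‖ ≤ R) : |F Y - F Z| ≤ 3 * D * R ^ (p - 1) * ‖Y - Z‖ := by
  have hp' : 0 ≤ p - 1 := by linarith
  have sum_le : 1 + ‖Y‖ ^ (p - 1) + ‖Z‖ ^ (p - 1) ≤ 3 * R ^ (p - 1) := by
    linarith [Real.one_le_rpow hR hp', Real.rpow_le_rpow (norm_nonneg _) hY hp',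
      Real.rpow_le_rpow (norm_nonneg _) hZ hp']
  calc |F Y - F Z| ≤ D * (3 * R ^ (p - 1)) * ‖Y - Z‖ := (hF Y Z).trans (by gcongr)
    _ = 3 * D * R ^ (p - 1) * ‖Y - Z‖ := by ring

theorem continuous (hF : PowerLipschitzWith p D F) (hp : 1 ≤ p) : Continuous F := by
  refine continuous_iff_continuousAt.2 fun Y => ?_
  have bound : ∀ᶠ Z in 𝓝 Y, dist (F Z) (F Y) ≤ 3 * D * (‖Y‖ + 1) ^ (p - 1) * ‖Z - Y‖ := by
    filter_upwards [continuous_norm.continuousAt.eventually_le_const (lt_add_one ‖Y‖)] with Z hZ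
    exact hF.abs_sub_le hp (by linarith [norm_nonneg Y]) hZ (by linarith)
  refine tendsto_iff_dist_tendsto_zero.2
    (squeeze_zero' (Eventually.of_forall fun _ => dist_nonneg) bound ?_)
  have vanish : Continuous fun Z => 3 * D * (‖Y‖ + 1) ^ (p - 1) * ‖Z - Y‖ := by fun_prop
  simpa using vanish.tendsto Y

theorem abs_le (hF : PowerLipschitzWith p D F) (hp : 1 ≤ p) (Y : E) :
    |F Y| ≤ |F 0| + 3 * D * (‖Y‖ + 1) ^ p := by
  have hY := norm_nonneg Y
  have diff : |F Y - F 0| ≤ 3 * D * (‖Y‖ + 1) ^ p :=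
    calc |F Y - F 0| ≤ 3 * D * (‖Y‖ + 1) ^ (p - 1) * ‖Y - 0‖ :=
          hF.abs_sub_le hp (by linarith) (by linarith) (by simpa using by linarith)
      _ ≤ 3 * D * ((‖Y‖ + 1) ^ (p - 1) * (‖Y‖ + 1)) := by
        rw [sub_zero, mul_assoc (3 * (D : ℝ))]
        gcongr
        linarith
      _ = 3 * D * (‖Y‖ + 1) ^ p := by rw [rpow_sub_one_mul_self hp (by linarith)]
  linarith [abs_sub_abs_le_abs_sub (F Y) (F 0)]

end PowerLipschitzWith

section Integrals

variable [IsFiniteMeasure μ] {U Φ : X → E}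

theorem integrable_norm_add_const_rpow (hp : 0 ≤ p) (hΦ : MemLp Φ (ENNReal.ofReal p) μ) {h : ℝ}
    (hh : 0 ≤ h) : Integrable (fun x => (‖Φ x‖ + h) ^ p) μ := by
  have norm_rpow := (hΦ.norm.add (memLp_const h)).integrable_norm_rpow'
  refine norm_rpow.congr (ae_of_all _ fun x => ?_)
  simp only [Pi.add_apply, ENNReal.toReal_ofReal hp]
  rw [Real.norm_of_nonneg (by positivity)]

theorem integrable_norm_rpow (hp : 0 ≤ p) (hΦ : MemLp Φ (ENNReal.ofReal p) μ) :
    Integrable (fun x => ‖Φ x‖ ^ p) μ := by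
  simpa using integrable_norm_add_const_rpow hp hΦ le_rfl

theorem integral_norm_add_const_rpow_le (hp : 1 ≤ p) (hΦ : MemLp Φ (ENNReal.ofReal p) μ) {h : ℝ}
    (hh : 0 ≤ h) :
    ∫ x, (‖Φ x‖ + h) ^ p ∂μ ≤ 2 ^ (p - 1) * ((∫ x, ‖Φ x‖ ^ p ∂μ) + μ.real Set.univ * h ^ p) := by
  have hint := integrable_norm_rpow (zero_le_one.trans hp) hΦ
  calc ∫ x, (‖Φ x‖ + h) ^ p ∂μ ≤ ∫ x, 2 ^ (p - 1) * (‖Φ x‖ ^ p + h ^ p) ∂μ :=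
        integral_mono (integrable_norm_add_const_rpow (zero_le_one.trans hp) hΦ hh)
          ((hint.add (integrable_const _)).const_mul _)
          fun x => add_rpow_le_mul_rpow_add_rpow hp (norm_nonneg _) hh
    _ = 2 ^ (p - 1) * ((∫ x, ‖Φ x‖ ^ p ∂μ) + μ.real Set.univ * h ^ p) := by
      rw [integral_const_mul, integral_add hint (integrable_const _), integral_const, smul_eq_mul]

namespace PowerLipschitzWith

theorem integrable_comp (hF : PowerLipschitzWith p D F) (hp : 1 ≤ p)
    (hΦ : MemLp Φ (ENNReal.ofReal p) μ) : Integrable (fun x => F (Φ x)) μ := by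
  have hp0 : 0 ≤ p := zero_le_one.trans hp
  refine Integrable.mono' ((integrable_const |F 0|).add
    ((integrable_norm_add_const_rpow hp0 hΦ zero_le_one).const_mul (3 * (D : ℝ))))
    ((hF.continuous hp).comp_aestronglyMeasurable hΦ.1) (ae_of_all _ fun _ => hF.abs_le hp _)

theorem integrable_comp_const_add (hF : PowerLipschitzWith p D F) (hp : 1 ≤ p)
    (hΦ : MemLp Φ (ENNReal.ofReal p) μ) (V : E) : Integrable (fun x => F (V + Φ x)) μ :=
  hF.integrable_comp hp ((memLp_const V).add hΦ)

theorem abs_integral_comp_const_add_le (hF : PowerLipschitzWith p D F) (hp : 1 ≤ p)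
    (hΦ : MemLp Φ (ENNReal.ofReal p) μ) {V : E} (hV : ‖V‖ ≤ K) :
    |∫ x, F (V + Φ x) ∂μ| ≤
      μ.real Set.univ * |F 0| + 3 * D * ∫ x, (‖Φ x‖ + (K + 1)) ^ p ∂μ := by
  have hp0 : 0 ≤ p := zero_le_one.trans hp
  have hK : 0 ≤ K := (norm_nonneg V).trans hV
  have hint := (integrable_norm_add_const_rpow hp0 hΦ (by linarith : 0 ≤ K + 1)).const_mul
    (3 * (D : ℝ))
  calc |∫ x, F (V + Φ x) ∂μ| ≤ ∫ x, |F (V + Φ x)| ∂μ := abs_integral_le_integral_abs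
    _ ≤ ∫ x, (|F 0| + 3 * D * (‖Φ x‖ + (K + 1)) ^ p) ∂μ := by
      refine integral_mono (hF.integrable_comp_const_add hp hΦ V).abs
        ((integrable_const _).add hint) fun x => (hF.abs_le hp _).trans ?_
      gcongr |F 0| + 3 * D * ?_ ^ p
      linarith [norm_add_le V (Φ x)]
    _ = _ := by
      rw [integral_add (integrable_const _) hint, integral_const, integral_const_mul, smul_eq_mul]

theorem integral_comp_const_add_le_add_norm_sub (hF : PowerLipschitzWith p D F) (hp : 1 ≤ p)
    (hΦ : MemLp Φ (ENNReal.ofReal p) μ) {V W : E} (hV : ‖V‖ ≤ K) (hW : ‖W‖ ≤ K) :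
    ∫ x, F (W + Φ x) ∂μ ≤
      (∫ x, F (V + Φ x) ∂μ) + 3 * D * (∫ x, (‖Φ x‖ + (K + 1)) ^ p ∂μ) * ‖W - V‖ := by
  have hp0 : 0 ≤ p := zero_le_one.trans hp
  have hK : 0 ≤ K := (norm_nonneg V).trans hV
  have hint := ((integrable_norm_add_const_rpow hp0 hΦ (by linarith : 0 ≤ K + 1)).const_mul
    (3 * (D : ℝ))).mul_const ‖W - V‖
  rw [← integral_const_mul, ← integral_mul_const,
    ← integral_add (hF.integrable_comp_const_add hp hΦ V) hint]
  refine integral_mono (hF.integrable_comp_const_add hp hΦ W)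
    ((hF.integrable_comp_const_add hp hΦ V).add hint) fun x => ?_
  have hR : 1 ≤ ‖Φ x‖ + (K + 1) := by linarith [norm_nonneg (Φ x)]
  have pointwise := hF.abs_sub_le hp hR (Y := W + Φ x) (Z := V + Φ x)
    (by linarith [norm_add_le W (Φ x)]) (by linarith [norm_add_le V (Φ x)])
  rw [add_sub_add_right_eq_sub] at pointwise
  have raise_exponent : (‖Φ x‖ + (K + 1)) ^ (p - 1) ≤ (‖Φ x‖ + (K + 1)) ^ p :=
    Real.rpow_le_rpow_of_exponent_le hR (by linarith)
  have step : 3 * D * (‖Φ x‖ + (K + 1)) ^ (p - 1) * ‖W - V‖ ≤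
      3 * D * (‖Φ x‖ + (K + 1)) ^ p * ‖W - V‖ := by gcongr
  linarith [le_abs_self (F (W + Φ x) - F (V + Φ x))]

theorem comp_add_le_comp_const_add (hF : PowerLipschitzWith p D F) (hp : 1 ≤ p) (hk : 1 ≤ k)
    (Y Z : E) {V : E} (hV : ‖V‖ ≤ K) :
    F (Y + Z) ≤ F (V + Z) +
      3 * D * 2 ^ (p - 1) * (‖Z‖ ^ p / k + k ^ (p - 1) * (‖Y‖ + (K + 1)) ^ p) := by
  have hK : 0 ≤ K := (norm_nonneg V).trans hV
  have hY := norm_nonneg Y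
  have hZ := norm_nonneg Z
  have lipschitz := hF.abs_sub_le hp (R := ‖Z‖ + (‖Y‖ + (K + 1))) (by linarith)
    (Y := Y + Z) (Z := V + Z) (by linarith [norm_add_le Y Z]) (by linarith [norm_add_le V Z])
  rw [add_sub_add_right_eq_sub] at lipschitz
  have young := add_rpow_sub_one_mul_le hp hk hZ (by linarith : 0 ≤ ‖Y‖ + (K + 1))
  have increment :=
    calc |F (Y + Z) - F (V + Z)|
      _ ≤ 3 * D * (‖Z‖ + (‖Y‖ + (K + 1))) ^ (p - 1) * (‖Y‖ + (K + 1)) := by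
        refine lipschitz.trans ?_
        gcongr
        linarith [norm_sub_le Y V]
      _ ≤ 3 * D * (2 ^ (p - 1) * (‖Z‖ ^ p / k + k ^ (p - 1) * (‖Y‖ + (K + 1)) ^ p)) := by
        rw [mul_assoc (3 * (D : ℝ))]
        gcongr
  linarith [le_abs_self (F (Y + Z) - F (V + Z))]

theorem integral_comp_add_le_integral_comp_const_add (hF : PowerLipschitzWith p D F) (hp : 1 ≤ p)
    (hk : 1 ≤ k) (hU : MemLp U (ENNReal.ofReal p) μ) (hΦ : MemLp Φ (ENNReal.ofReal p) μ) {V : E}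
    (hV : ‖V‖ ≤ K) :
    ∫ x, F (U x + Φ x) ∂μ ≤ (∫ x, F (V + Φ x) ∂μ) + 3 * D * 2 ^ (p - 1) *
      ((∫ x, ‖Φ x‖ ^ p ∂μ) / k + k ^ (p - 1) * ∫ x, (‖U x‖ + (K + 1)) ^ p ∂μ) := by
  have hp0 : 0 ≤ p := zero_le_one.trans hp
  have hK : 0 ≤ K := (norm_nonneg V).trans hV
  have hΦp := (integrable_norm_rpow hp0 hΦ).div_const k
  have hUp := (integrable_norm_add_const_rpow hp0 hU (by linarith : 0 ≤ K + 1)).const_mul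
    (k ^ (p - 1))
  have hV_int := hF.integrable_comp_const_add hp hΦ V
  have err_int : Integrable (fun x => 3 * D * 2 ^ (p - 1) *
      (‖Φ x‖ ^ p / k + k ^ (p - 1) * (‖U x‖ + (K + 1)) ^ p)) μ := (hΦp.add hUp).const_mul _
  rw [← integral_div, ← integral_const_mul, ← integral_add hΦp hUp, ← integral_const_mul,
    ← integral_add hV_int err_int]
  exact integral_mono (hF.integrable_comp hp (hU.add hΦ)) (hV_int.add err_int)
    fun x => hF.comp_add_le_comp_const_add hp hk (U x) (Φ x) hV

theorem integral_comp_add_le_of_eq_zero (hF : PowerLipschitzWith p D F) (hp : 1 ≤ p) (hk : 1 ≤ k)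
    (hU : MemLp U (ENNReal.ofReal p) μ) (hΦ : MemLp Φ (ENNReal.ofReal p) μ) {V : E}
    (hV : ‖V‖ ≤ K) {s : Set X} (hs : MeasurableSet s) (hΦs : ∀ x ∉ s, Φ x = 0) :
    ∫ x, F (U x + Φ x) ∂μ ≤ (∫ x, |F (U x)| ∂μ) + (∫ x in s, F (V + Φ x) ∂μ) +
      3 * D * 2 ^ (p - 1) * ((∫ x in s, ‖Φ x‖ ^ p ∂μ) / k +
        k ^ (p - 1) * ∫ x in s, (‖U x‖ + (K + 1)) ^ p ∂μ) := by
  have hFU := (hF.integrable_comp hp hU).abs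
  have inside := hF.integral_comp_add_le_integral_comp_const_add hp hk (hU.restrict s)
    (hΦ.restrict s) hV
  have outside : ∫ x in sᶜ, F (U x + Φ x) ∂μ ≤ ∫ x, |F (U x)| ∂μ :=
    calc ∫ x in sᶜ, F (U x + Φ x) ∂μ = ∫ x in sᶜ, F (U x) ∂μ :=
          setIntegral_congr_fun hs.compl fun x hx => by simp only [hΦs x hx, add_zero]
      _ ≤ ∫ x in sᶜ, |F (U x)| ∂μ :=
        integral_mono (hF.integrable_comp hp (hU.restrict _)) hFU.restrict fun _ => le_abs_self _
      _ ≤ ∫ x, |F (U x)| ∂μ := setIntegral_le_integral hFU (ae_of_all _ fun _ => abs_nonneg _)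
  have hint : Integrable (fun x => F (U x + Φ x)) μ := hF.integrable_comp hp (hU.add hΦ)
  linarith [integral_add_compl hs hint]

end PowerLipschitzWith

end Integrals

end PowerLipschitz

/-! ### Coercivity bounds the energy of test functions -/

section Coercivity

variable {a : Fin N → ℕ+} {p K k M : ℝ} {D : ℝ≥0} {F : GradSpace n a → ℝ}
  {Ω : Set (EuclideanSpace ℝ (Fin N))} {U : EuclideanSpace ℝ (Fin N) → GradSpace n a}

/-- The averaged energy `⨍_Q F(V + ∇_a φ)`, whose infimum over `φ ∈ C_c^∞(Q)` is the
`a`-quasiconvex envelope of `F` at `V`. -/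
noncomputable def cubeEnergy (a : Fin N → ℕ+) (F : GradSpace n a → ℝ)
    (φ : EuclideanSpace ℝ (Fin N) → EuclideanSpace ℝ (Fin n)) (V : GradSpace n a) : ℝ :=
  ⨍ x in cube N, F (V + aGrad a φ x)

theorem integral_norm_rpow_le_of_eLpNorm_le {E X : Type*} [NormedAddCommGroup E]
    {mX : MeasurableSpace X} {μ : Measure X} {Φ : X → E} (hp : 0 < p)
    (hΦ : MemLp Φ (ENNReal.ofReal p) μ) {B : ℝ≥0} (hB : eLpNorm Φ (ENNReal.ofReal p) μ ≤ B) :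
    ∫ x, ‖Φ x‖ ^ p ∂μ ≤ (B : ℝ) ^ p := by
  rw [hΦ.eLpNorm_eq_integral_rpow_norm (by simpa using hp) ENNReal.ofReal_ne_top,
    ENNReal.toReal_ofReal hp.le, ← ENNReal.ofReal_coe_nnreal,
    ENNReal.ofReal_le_ofReal_iff B.coe_nonneg] at hB
  exact (Real.rpow_inv_le_iff_of_pos (integral_nonneg fun _ => by positivity) B.coe_nonneg hp).1 hB

theorem CoerciveOn.exists_eLpNorm_aGrad_le
    {g : EuclideanSpace ℝ (Fin N) → EuclideanSpace ℝ (Fin n)} (h : CoerciveOn a p p F Ω g)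
    (hp : 1 ≤ p) (hgrad : HasWeakGrad a Ω g U)
    (hU : MemLp U (ENNReal.ofReal p) (volume.restrict Ω)) (M : ℝ) :
    ∃ B : ℝ≥0, ∀ ψ, IsTest Ω ψ → ∫ x in Ω, F (U x + aGrad a ψ x) ≤ M →
      eLpNorm (aGrad a ψ) (ENNReal.ofReal p) (volume.restrict Ω) ≤ B := by
  by_contra! unbounded
  lift eLpNorm U (ENNReal.ofReal p) (volume.restrict Ω) to ℝ≥0 using hU.eLpNorm_ne_top
    with b hb
  choose ψ hψ energy_le large using fun j : ℕ => unbounded (j + b)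
  have le_norm_add (j : ℕ) :
      (j : ℝ≥0∞) ≤ eLpNorm (U + aGrad a (ψ j)) (ENNReal.ofReal p) (volume.restrict Ω) := by
    have meas : AEStronglyMeasurable (aGrad a (ψ j)) (volume.restrict Ω) :=
      ((hψ j).continuous_aGrad a).aestronglyMeasurable
    have triangle := eLpNorm_sub_le (p := ENNReal.ofReal p) (hU.1.add meas) hU.1 (by simpa using hp)
    rw [add_sub_cancel_left, ← hb] at triangle
    exact (ENNReal.add_le_add_iff_right ENNReal.coe_ne_top).1
      ((by exact_mod_cast (large j).le : (j : ℝ≥0∞) + b ≤ _).trans triangle)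
  have diverges := h (fun j => g + ψ j) (fun j => U + aGrad a (ψ j))
    (fun j => ⟨ψ j, (hψ j).memW0 a p, rfl⟩) (fun j => hgrad.add_aGrad (hψ j).1)
    (tendsto_nhds_top_mono' ENNReal.tendsto_nat_nhds_top le_norm_add)
  obtain ⟨j, hj⟩ := (diverges.eventually_gt_atTop M).exists
  exact (energy_le j).not_gt hj

theorem eventually_exists_isTest_setIntegral_eq [NeZero N] (a : Fin N → ℕ+)
    (hΩ : IsOpen Ω) (hne : Ω.Nonempty) {f : EuclideanSpace ℝ (Fin N) → ℝ}
    (hf : IntegrableOn f Ω) {ε : ℝ} (hε : 0 < ε) :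
    ∀ᶠ v in 𝓝[>] 0, ∃ s ⊆ Ω, MeasurableSet s ∧ ∫ x in s, f x ≤ ε ∧
      ∀ φ : EuclideanSpace ℝ (Fin N) → EuclideanSpace ℝ (Fin n), IsTest (cube N) φ →
        ∃ ψ, IsTest s ψ ∧ ∀ H : GradSpace n a → ℝ,
          ∫ x in s, H (aGrad a ψ x) = v * ⨍ x in cube N, H (aGrad a φ x) := by
  obtain ⟨x₀, hx₀⟩ := hne
  have inside := eventually_box_subset a (hΩ.mem_nhds hx₀)
  have small := eventually_setIntegral_box_le a x₀ Measure.restrict_le_self hf hε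
  filter_upwards [exists_volume_real_box_eq a x₀ (inside.and small)] with
    v ⟨r, hr, ⟨hsub, hsmall⟩, hvol⟩
  rw [Measure.restrict_restrict_of_subset hsub] at hsmall
  refine ⟨_, hsub, measurableSet_box a x₀ r, hsmall, fun φ hφ =>
    ⟨_, hφ.smul_comp_rescale a x₀ hr r, fun H => ?_⟩⟩
  rw [setIntegral_box_comp_aGrad a x₀ hr hφ.1, hvol]

/-- The affine part `V` is replaced by the field `U` at a cost which does not depend on the
energy `k` that the rescaled function is given. -/
theorem eventually_exists_isTest_energy_eq [NeZero N] (hF : PowerLipschitzWith p D F) (hp : 1 ≤ p)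
    (hΩ : IsOpen Ω) (hb : Bornology.IsBounded Ω) (hne : Ω.Nonempty)
    (hU : MemLp U (ENNReal.ofReal p) (volume.restrict Ω)) (hK : 0 ≤ K) (hM : 0 ≤ M) (hk : 1 ≤ k) :
    ∀ᶠ T in atTop, ∀ V φ, ‖V‖ ≤ K → IsTest (cube N) φ → cubeEnergy a F φ V ≤ M →
      ⨍ x in cube N, ‖aGrad a φ x‖ ^ p = T →
      ∃ ψ, IsTest Ω ψ ∧ ∫ x in Ω, ‖aGrad a ψ x‖ ^ p = k ∧
        ∫ x in Ω, F (U x + aGrad a ψ x) ≤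
          (∫ x in Ω, |F (U x)|) + M + 3 * D * 2 ^ (p - 1) * 2 := by
  have hp0 : 0 ≤ p := zero_le_one.trans hp
  have hk0 : 0 < k := by linarith
  have hkp : 0 < k ^ (p - 1) := Real.rpow_pos_of_pos hk0 _
  have finite : IsFiniteMeasure (volume.restrict Ω) := ⟨by simpa using hb.measure_lt_top⟩
  have boxes := eventually_exists_isTest_setIntegral_eq (n := n) a hΩ hne
    (integrable_norm_add_const_rpow hp0 hU (by linarith : 0 ≤ K + 1)) (inv_pos.2 hkp)
  have volumes : Tendsto (fun T => k / T) atTop (𝓝[>] 0) := by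
    simpa only [Function.comp_def, inv_div, id] using
      tendsto_inv_atTop_nhdsGT_zero.comp (tendsto_id.atTop_div_const hk0)
  filter_upwards [volumes.eventually boxes, eventually_ge_atTop k] with
    T ⟨s, hsub, hs, small, rescaled⟩ hT V φ hV hφ henergy hnorm
  have hT0 : 0 < T := by linarith
  obtain ⟨ψ, hψ, integral_eq⟩ := rescaled φ hφ
  have vanishes (x) (hx : x ∉ s) : aGrad a ψ x = 0 := hψ.aGrad_eq_zero a hx
  have norm_eq : ∫ x in s, ‖aGrad a ψ x‖ ^ p = k := by
    rw [integral_eq fun X => ‖X‖ ^ p, hnorm, div_mul_cancel₀ _ hT0.ne']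
  have energy_le : ∫ x in s, F (V + aGrad a ψ x) ≤ M :=
    calc ∫ x in s, F (V + aGrad a ψ x) = k / T * cubeEnergy a F φ V :=
        integral_eq fun X => F (V + X)
      _ ≤ k / T * M := by gcongr
      _ ≤ M := mul_le_of_le_one_left hM (div_le_one_of_le₀ hT hT0.le)
  refine ⟨ψ, hψ.mono hsub, ?_, ?_⟩
  · rw [← norm_eq]
    exact setIntegral_eq_of_subset_of_forall_sdiff_eq_zero hΩ.measurableSet hsub fun x hx => by
      rw [vanishes x hx.2, norm_zero, Real.zero_rpow (by linarith)]
  · have replaced := hF.integral_comp_add_le_of_eq_zero hp hk hU (hψ.memLp_aGrad a) hV hs vanishes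
    rw [Measure.restrict_restrict_of_subset hsub, norm_eq, div_self hk0.ne'] at replaced
    have error_le : k ^ (p - 1) * ∫ x in s, (‖U x‖ + (K + 1)) ^ p ≤ 1 := by
      rwa [← le_inv_mul_iff₀ hkp, mul_one]
    have cost_le : 3 * D * 2 ^ (p - 1) * (1 + k ^ (p - 1) * ∫ x in s, (‖U x‖ + (K + 1)) ^ p) ≤
        3 * D * 2 ^ (p - 1) * 2 := by
      gcongr
      linarith
    linarith

theorem LpCoercive.exists_average_norm_aGrad_le (hco : LpCoercive a p F) (hp : 1 ≤ p)
    (hF : PowerLipschitzWith p D F) (hK : 0 ≤ K) (hM : 0 ≤ M) :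
    ∃ B, ∀ V φ, ‖V‖ ≤ K → IsTest (cube N) φ → cubeEnergy a F φ V ≤ M →
      ⨍ x in cube N, ‖aGrad a φ x‖ ^ p ≤ B := by
  rcases N.eq_zero_or_pos with rfl | hN
  · have : IsEmpty (TopIndex a) := ⟨fun α => by simpa [weight] using α.2⟩
    refine ⟨0, fun V φ _ _ _ => ?_⟩
    simp [Subsingleton.elim (aGrad a φ _) 0, (zero_lt_one.trans_le hp).ne']
  have : NeZero N := ⟨hN.ne'⟩
  obtain ⟨Ω, g, hΩ, hb, hne, hg, hcoercive⟩ := hco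
  obtain ⟨U, hU, hgrad⟩ := hg.exists_hasWeakGrad
  have hUΩ := hU.mono_measure (Measure.restrict_mono_set volume (Set.subset_univ Ω))
  obtain ⟨B, hB⟩ := hcoercive.exists_eLpNorm_aGrad_le hp (hgrad.mono (Set.subset_univ Ω)) hUΩ
    ((∫ x in Ω, |F (U x)|) + M + 3 * D * 2 ^ (p - 1) * 2)
  have hBp : 0 ≤ (B : ℝ) ^ p := by positivity
  obtain ⟨T₀, hT₀⟩ := eventually_atTop.1 <| eventually_exists_isTest_energy_eq (n := n) hF hp hΩ hb
    hne hUΩ hK hM (by linarith : 1 ≤ (B : ℝ) ^ p + 1)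
  refine ⟨T₀, fun V φ hV hφ henergy => ?_⟩
  by_contra! large
  obtain ⟨ψ, hψ, norm_eq, energy_le⟩ := hT₀ _ large.le V φ hV hφ henergy rfl
  have norm_le := integral_norm_rpow_le_of_eLpNorm_le (zero_lt_one.trans_le hp) (hψ.memLp_aGrad a)
    (hB ψ hψ energy_le)
  linarith

end Coercivity

/-! ### The envelope -/

theorem lipschitzOnWith_ciInf {ι E : Type*} [Nonempty ι] [PseudoMetricSpace E] {f : ι → E → ℝ}
    {s : Set E} {c : ℝ} {L : ℝ≥0} (hbdd : ∀ x ∈ s, BddBelow (Set.range fun i => f i x))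
    (hc : ∀ x ∈ s, ⨅ i, f i x < c)
    (hf : ∀ i, ∀ x ∈ s, ∀ y ∈ s, f i x ≤ c → f i y ≤ f i x + L * dist y x) :
    LipschitzOnWith L (fun x => ⨅ i, f i x) s := by
  refine LipschitzOnWith.of_le_add_mul L fun y hy x hx => ?_
  rw [← sub_le_iff_le_add]
  refine le_of_forall_gt fun b hb => ?_
  obtain ⟨i, hi⟩ := exists_lt_of_ciInf_lt (lt_min hb (hc x hx))
  have transfer := hf i x hx y hy (hi.le.trans (min_le_right _ _))
  have lower : ⨅ i, f i y ≤ f i y := ciInf_le (hbdd y hy) i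
  linarith [hi.trans_le (min_le_left b c)]

section Envelope

variable {a : Fin N → ℕ+} {p K : ℝ} {D : ℝ≥0} {F : GradSpace n a → ℝ}

variable (N n) in
/-- The test maps `C_c^∞(Q; ℝⁿ)` on the cube, as an index type for the envelope. -/
abbrev CubeTest : Type :=
  {φ : EuclideanSpace ℝ (Fin N) → EuclideanSpace ℝ (Fin n) // IsTest (cube N) φ}

instance : Nonempty (CubeTest N n) := ⟨⟨0, isTest_zero _⟩⟩

/-- The `a`-quasiconvex envelope with values in `ℝ`. The infimum is junk, namely `0`, where the
energies are not bounded below. -/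
noncomputable def realEnvelope (a : Fin N → ℕ+) (F : GradSpace n a → ℝ) (V : GradSpace n a) : ℝ :=
  ⨅ φ : CubeTest N n, cubeEnergy a F φ.1 V

theorem qcEnvelope_eq_realEnvelope {V : GradSpace n a}
    (hbdd : BddBelow (Set.range fun φ : CubeTest N n => cubeEnergy a F φ.1 V)) :
    qcEnvelope a F V = (realEnvelope a F V : EReal) :=
  (EReal.coe_strictMono.monotone.map_ciInf_of_continuousAt
    continuous_coe_real_ereal.continuousAt hbdd).symm

theorem cubeEnergy_zero (a : Fin N → ℕ+) (F : GradSpace n a → ℝ) (V : GradSpace n a) :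
    cubeEnergy a F 0 V = F V := by
  have hzero (x : EuclideanSpace ℝ (Fin N)) :
      aGrad a (0 : EuclideanSpace ℝ (Fin N) → EuclideanSpace ℝ (Fin n)) x = 0 :=
    (isTest_zero ∅).aGrad_eq_zero a (Set.notMem_empty x)
  simp only [cubeEnergy, hzero, add_zero]
  exact setAverage_const (volume_cube_pos N).ne' (isBounded_cube N).measure_lt_top.ne _

theorem setAverage_cube_eq_integral_cond (f : EuclideanSpace ℝ (Fin N) → ℝ) :
    ⨍ x in cube N, f x = ∫ x, f x ∂(ProbabilityTheory.cond volume (cube N)) :=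
  setAverage_eq' _ _ _

instance : IsProbabilityMeasure (ProbabilityTheory.cond volume (cube N)) :=
  ProbabilityTheory.cond_isProbabilityMeasure_of_finite (volume_cube_pos N).ne'
    (isBounded_cube N).measure_lt_top.ne

theorem LpCoercive.exists_integral_norm_aGrad_add_const_le (hco : LpCoercive a p F) (hp : 1 ≤ p)
    (hF : PowerLipschitzWith p D F) (hK : 0 ≤ K) {c : ℝ} (hc : 0 ≤ c) :
    ∃ R : ℝ≥0, ∀ V φ, ‖V‖ ≤ K → IsTest (cube N) φ → cubeEnergy a F φ V ≤ c →
      ∫ x, (‖aGrad a φ x‖ + (K + 1)) ^ p ∂(ProbabilityTheory.cond volume (cube N)) ≤ R := by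
  obtain ⟨B, hB⟩ := hco.exists_average_norm_aGrad_le hp hF hK hc
  refine ⟨(2 ^ (p - 1) * (B + (K + 1) ^ p)).toNNReal, fun V φ hV hφ henergy => ?_⟩
  refine (integral_norm_add_const_rpow_le hp (hφ.memLp_aGrad a) (by linarith)).trans
    (le_trans ?_ (Real.le_coe_toNNReal _))
  rw [probReal_univ, one_mul, ← setAverage_cube_eq_integral_cond]
  gcongr
  exact hB V φ hV hφ henergy

theorem LpCoercive.bddBelow_cubeEnergy (hco : LpCoercive a p F) (hp : 1 ≤ p)
    (hF : PowerLipschitzWith p D F) (V : GradSpace n a) :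
    BddBelow (Set.range fun φ : CubeTest N n => cubeEnergy a F φ.1 V) := by
  obtain ⟨R, hR⟩ := hco.exists_integral_norm_aGrad_add_const_le hp hF (norm_nonneg V) le_rfl
  refine ⟨-(|F 0| + 3 * D * R), ?_⟩
  rintro _ ⟨⟨φ, hφ⟩, rfl⟩
  rcases le_total (cubeEnergy a F φ V) 0 with hneg | hpos
  · have bound := hF.abs_integral_comp_const_add_le hp (hφ.memLp_aGrad a) le_rfl
      (μ := ProbabilityTheory.cond volume (cube N)) (V := V)
    rw [← setAverage_cube_eq_integral_cond, probReal_univ, one_mul] at bound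
    refine neg_le_of_neg_le ((neg_le_abs _).trans (bound.trans ?_))
    gcongr
    exact hR V φ le_rfl hφ hneg
  · exact (neg_nonpos.2 (by positivity)).trans hpos

theorem LpCoercive.exists_lipschitzOnWith_realEnvelope (hco : LpCoercive a p F) (hp : 1 ≤ p)
    (hF : PowerLipschitzWith p D F) (hK : 0 ≤ K) :
    ∃ L, LipschitzOnWith L (realEnvelope a F) (Metric.closedBall 0 K) := by
  set c := |F 0| + 3 * D * (K + 1) ^ p
  obtain ⟨R, hR⟩ := hco.exists_integral_norm_aGrad_add_const_le hp hF hK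
    (show 0 ≤ c + 1 by positivity)
  refine ⟨3 * D * R, lipschitzOnWith_ciInf (c := c + 1)
    (fun V _ => hco.bddBelow_cubeEnergy hp hF V) (fun V hV => ?_) fun φ V hV W hW henergy => ?_⟩
  · rw [mem_closedBall_zero_iff] at hV
    calc realEnvelope a F V ≤ cubeEnergy a F 0 V :=
          ciInf_le (hco.bddBelow_cubeEnergy hp hF V) ⟨0, isTest_zero _⟩
      _ = F V := cubeEnergy_zero a F V
      _ ≤ |F 0| + 3 * D * (‖V‖ + 1) ^ p := (le_abs_self _).trans (hF.abs_le hp V)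
      _ ≤ |F 0| + 3 * D * (K + 1) ^ p := by gcongr
      _ < c + 1 := lt_add_one c
  · rw [mem_closedBall_zero_iff] at hV hW
    have transfer := hF.integral_comp_const_add_le_add_norm_sub hp (φ.2.memLp_aGrad a) hV hW
      (μ := ProbabilityTheory.cond volume (cube N))
    rw [← setAverage_cube_eq_integral_cond, ← setAverage_cube_eq_integral_cond] at transfer
    refine transfer.trans (add_le_add le_rfl ?_)
    rw [dist_eq_norm]
    push_cast
    gcongr
    exact hR V φ hV φ.2 henergy

theorem LpCoercive.locallyLipschitz_realEnvelope (hco : LpCoercive a p F) (hp : 1 ≤ p)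
    (hF : PowerLipschitzWith p D F) : LocallyLipschitz (realEnvelope a F) := fun V => by
  obtain ⟨L, hL⟩ := hco.exists_lipschitzOnWith_realEnvelope hp hF
    (show 0 ≤ ‖V‖ + 1 by positivity)
  exact ⟨L, _, Metric.closedBall_mem_nhds_of_mem (by simp), hL⟩

end Envelope

end MixedSmoothness

theorem mainTheorem8_general {N n : ℕ} (a : Fin N → ℕ+) (p : ℝ) (hp : 1 ≤ p)
    (F : GradSpace n a → ℝ) (hF_coercive : LpCoercive a p F)
    (hF_lip : ∃ D : ℝ, ∀ X W,
      |F X - F W| ≤ D * (1 + ‖X‖ ^ (p - 1) + ‖W‖ ^ (p - 1)) * ‖X - W‖) :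
    ∃ G : GradSpace n a → ℝ, LocallyLipschitz G ∧ ∀ X, qcEnvelope a F X = (G X : EReal) := by
  obtain ⟨D, hD⟩ := hF_lip
  have hF : PowerLipschitzWith p D.toNNReal F := fun X W => (hD X W).trans <| by
    gcongr
    exact Real.le_coe_toNNReal D
  exact ⟨realEnvelope a F, hF_coercive.locallyLipschitz_realEnvelope hp hF,
    fun X => qcEnvelope_eq_realEnvelope (hF_coercive.bddBelow_cubeEnergy hp hF X)⟩

theorem mainTheorem8 {N n : ℕ} (a : Fin N → ℕ+) (p : ℝ) (hp : 1 < p)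
    (F : GradSpace n a → ℝ) (hF_nonneg : ∀ X, 0 ≤ F X) (hF_cont : Continuous F)
    (hF_coercive : LpCoercive a p F)
    (hF_growth : ∃ C : ℝ, ∀ X, F X ≤ C * (‖X‖ ^ p + 1))
    (hF_lip : ∃ D : ℝ, ∀ X W,
      |F X - F W| ≤ D * (1 + ‖X‖ ^ (p - 1) + ‖W‖ ^ (p - 1)) * ‖X - W‖) :
    ∃ G : GradSpace n a → ℝ, Continuous G ∧ ∀ X, qcEnvelope a F X = (G X : EReal) := by
  obtain ⟨G, hG, hQ⟩ := mainTheorem8_general a p hp.le F hF_coercive hF_lip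
  exact ⟨G, hG.continuous, hQ⟩
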